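/- For an $N\times N$ real symmetric matrix $X$ with eigenvalues $\lambda_1(X)\le\dots\le\lambda_N(X)$ and $1\le k\le N$, let $\mathcal P_k^+(X)=\sum_{i=1}^k\lambda_{N+1-i}(X)$. For an open set $\Omega\subset\mathbb R^N$ let $$\mu_k^+(\Omega)=\sup\{\mu\in\mathbb R:\ \exists\,\phi>0 \text{ in }\Omega \text{ lower semicontinuous with } \mathcal P_k^+(D^2\phi)+\mu\phi\le 0 \text{ in }\Omega \text{ in the viscosity sense}\}\in[-\infty,+\infty].$$ Let $1\le k\le N$ be integers, let $\rho>0$, let $B_\rho$ be the open ball of radius $\rho$ centred at the origin of $\mathbb R^N$, and let $\mu(\Delta)$ be the infimum of the real numbers $\mu$ for which there is a function $\phi\not\equiv0$, of class $C^2$ in the open ball $B^{(k)}_\rho\subset\mathbb R^k$ of radius $\rho$ centred at the origin and continuous on its closure, with $\Delta\phi+\mu\phi=0$ in $B^{(k)}_\rho$ and $\phi=0$ on $\partial B^{(k)}_\rho$. Then: 1. The infimum $\mu(\Delta)$ is attained, so it is the first Dirichlet eigenvalue of the Laplacian in $B^{(k)}_\rho$, and it has a positive radial eigenfunction $y\mapsto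 v(|y|)$. 2. For every $v$ such that $y\mapsto v(|y|)$ is an eigenfunction as above for the eigenvalue $\mu(\Delta)$ and is positive in $B^{(k)}_\rho$, the function $u(x)=v(|x|)$ is of class $C^2$ and positive in $B_\rho\subset\mathbb R^N$, is continuous on $\overline{B_\rho}$, vanishes on $\partial B_\rho$, and satisfies $$\mathcal P_k^+(D^2u)+\mu(\Delta)\,u=0\quad\text{in } B_\rho .$$ 3. $\mu_k^+(B_\rho)=\mu(\Delta)$. In particular $u$ is a principal eigenfunction of $\mathcal P_k^+$ in $B_\rho$, for every $k$ (also for $k>1$). -/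

import Mathlib

noncomputable section

/-- The Hessian matrix `D²f(x)` of a function on `ℝᴺ`. -/
def hessianMatrix {N : ℕ} (f : EuclideanSpace ℝ (Fin N) → ℝ) (x : EuclideanSpace ℝ (Fin N)) :
    Matrix (Fin N) (Fin N) ℝ :=
  Matrix.of fun i j =>
    fderiv ℝ (fderiv ℝ f) x (EuclideanSpace.single i 1) (EuclideanSpace.single j 1)

/-- The Hessian matrix of a function of class `C²` near `x` is symmetric. -/
theorem hessianMatrix_isHermitian {N : ℕ} {f : EuclideanSpace ℝ (Fin N) → ℝ}
    {x : EuclideanSpace ℝ (Fin N)} (hf : ContDiffAt ℝ 2 f x) :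
    (hessianMatrix f x).IsHermitian := by
  have h : IsSymmSndFDerivAt ℝ f x := hf.isSymmSndFDerivAt (by simp)
  ext i j
  simpa [hessianMatrix] using h.eq _ _

open Classical in
/-- The truncated Laplacian `P⁺ₖ(X) = λ_N(X) + ⋯ + λ_{N+1-k}(X)`, the sum of the `k` largest
eigenvalues (with multiplicity) of a symmetric matrix `X`. Mathlib's `eigenvalues₀` lists the
eigenvalues in nonincreasing order, with indices starting from `0`. The value at a matrix that
is not symmetric is irrelevant. -/
def truncatedPlus {N : ℕ} (k : ℕ) (X : Matrix (Fin N) (Fin N) ℝ) : ℝ :=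
  if hX : X.IsHermitian then
    ∑ i : Fin (Fintype.card (Fin N)) with i.val < k, hX.eigenvalues₀ i
  else 0

/-- `φ` is a viscosity supersolution of `P⁺ₖ(D²φ) + μ φ ≤ 0` in the open set `Ω`: it is lower
semicontinuous in `Ω`, and the inequality holds at `x ∈ Ω` for the Hessian of every function `ψ`
of class `C²` near `x` such that `φ - ψ` has a local minimum at `x`. -/
def IsViscositySupersolution {N : ℕ} (k : ℕ) (Ω : Set (EuclideanSpace ℝ (Fin N))) (μ : ℝ)
    (φ : EuclideanSpace ℝ (Fin N) → ℝ) : Prop :=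
  LowerSemicontinuousOn φ Ω ∧
    ∀ x ∈ Ω, ∀ ψ : EuclideanSpace ℝ (Fin N) → ℝ, ContDiffAt ℝ 2 ψ x →
      IsLocalMin (fun y => φ y - ψ y) x →
        truncatedPlus k (hessianMatrix ψ x) + μ * φ x ≤ 0

/-- The generalized principal eigenvalue
`μₖ⁺(Ω) = sup {μ ∈ ℝ | ∃ φ > 0 in Ω, P⁺ₖ(D²φ) + μ φ ≤ 0 in Ω}`, as an extended real number. -/
def muPlus {N : ℕ} (k : ℕ) (Ω : Set (EuclideanSpace ℝ (Fin N))) : EReal :=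
  sSup ((fun μ : ℝ => (μ : EReal)) ''
    {μ : ℝ | ∃ φ : EuclideanSpace ℝ (Fin N) → ℝ,
      (∀ x ∈ Ω, 0 < φ x) ∧ IsViscositySupersolution k Ω μ φ})

/-- `φ` is a (classical) Dirichlet eigenfunction of the Laplacian in `Ω` with eigenvalue `μ`:
it does not vanish identically in `Ω`, and `Δφ + μ φ = 0` in `Ω`, `φ = 0` on `∂Ω`. -/
structure IsDirichletEigenfunction {k : ℕ} (Ω : Set (EuclideanSpace ℝ (Fin k))) (μ : ℝ)
    (φ : EuclideanSpace ℝ (Fin k) → ℝ) : Prop where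
  contDiffOn : ContDiffOn ℝ 2 φ Ω
  continuousOn : ContinuousOn φ (closure Ω)
  nontrivial : ∃ x ∈ Ω, φ x ≠ 0
  equation : ∀ x ∈ Ω, Laplacian.laplacian φ x + μ * φ x = 0
  boundary : ∀ x ∈ frontier Ω, φ x = 0

/-- The first (smallest) Dirichlet eigenvalue `μ(Δ)` of the Laplacian in the open ball of
radius `ρ` centred at the origin of `ℝᵏ`. -/
def muLaplacianBall (k : ℕ) (ρ : ℝ) : ℝ :=
  sInf {μ : ℝ | ∃ φ : EuclideanSpace ℝ (Fin k) → ℝ,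
    IsDirichletEigenfunction (Metric.ball 0 ρ) μ φ}

/-- `v` is the profile of a radial first Dirichlet eigenfunction of the Laplacian in the ball of
radius `ρ` of `ℝᵏ`: the function `y ↦ v (|y|)` is positive in the ball and is a Dirichlet
eigenfunction for the first eigenvalue. -/
def IsRadialFirstEigenfunction (k : ℕ) (ρ : ℝ) (v : ℝ → ℝ) : Prop :=
  IsDirichletEigenfunction (Metric.ball (0 : EuclideanSpace ℝ (Fin k)) ρ)
      (muLaplacianBall k ρ) (fun y => v ‖y‖) ∧
    ∀ y ∈ Metric.ball (0 : EuclideanSpace ℝ (Fin k)) ρ, 0 < v ‖y‖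

end

/-!
Everything rests on the entire solution `g` of `4 s g'' + 2 k g' + g = 0`, `g 0 = 1`, given by a
power series (`besselProfile`), for which `x ↦ g (μ |x|²)` satisfies `Δφ + μφ = 0` in `ℝᵏ`. Its
derivative is `-1 / (2 k)` times the corresponding function with `k + 2` in place of `k`.
Let `Z` be its first positive zero (`exists_besselProfile_first_zero`).

*The Laplacian.* The maximum principle applied to a quotient (Barta's principle,
`exists_laplacian_mul_le`) compares any function vanishing on the boundary of a ball with
`g (μ' |x|²)`, `μ'` slightly smaller than `Z / ρ²`. It shows that no Dirichlet eigenvalue in the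
ball of radius `ρ` is below `Z / ρ²`, a value attained by `g (Z |x|² / ρ²)`. Applied in smaller
balls, it also shows that radial first eigenfunctions are multiples of this one
(`radial_eigenfunction_eq`), so that no regularity theory is needed for them.

*The truncated Laplacian.* The Hessian of `f (|x|²)` in `ℝᴺ` is `2 f' I + 4 f'' x xᵀ`, so if
`f'' ≥ 0` the sum of its `k` largest eigenvalues is `2 k f' + 4 |x|² f''`, the Laplacian of the same
profile in `ℝᵏ`. For `f = g` the sign condition `g'' ≥ 0` holds up to `Z`, since the profiles with
parameters `k + 2` and `k + 4` are positive as long as `g` is (`besselProfile_add_two_pos`).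
Hence `g (Z |x|² / ρ²)` is an eigenfunction of `P⁺ₖ`, and a viscosity supersolution because
`P⁺ₖ` is monotone (`truncatedPlus_le`). A positive supersolution with a larger `μ` would be
touched from below by a multiple of the eigenfunction of a smaller ball, with eigenvalue
`μ' ∈ (Z / ρ², μ)`, contradicting the viscosity inequality at the contact point
(`muPlus_ball_eq`).
-/

/-! ### A power series solution of the radial equation -/

/-- The coefficients `(-1)ᵐ / (m! ∏_{i<m} (2k + 4i))` of the power series `besselProfile k`. -/
noncomputable def besselCoeff (k m : ℕ) : ℝ :=
  (-1) ^ m / (m.factorial * ∏ i ∈ Finset.range m, (2 * k + 4 * i : ℝ))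

/-- The entire solution of `4 s g'' + 2 k g' + g = 0` with `g 0 = 1`. For `k ≥ 1` this is the
equation saying that `x ↦ g (|x|²)` satisfies `Δφ + φ = 0` in `ℝᵏ`; up to normalization `g (r²)`
is `r ^ (1 - k / 2) * J_{k/2-1} r`, with `J` a Bessel function. -/
noncomputable def besselProfile (k : ℕ) (s : ℝ) : ℝ := ∑' m, besselCoeff k m * s ^ m

theorem abs_besselCoeff_le {k : ℕ} (hk : 1 ≤ k) (m : ℕ) :
    |besselCoeff k m| ≤ 1 / m.factorial := by
  have hk' : (1 : ℝ) ≤ k := by exact_mod_cast hk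
  have h1 : (1 : ℝ) ≤ ∏ i ∈ Finset.range m, (2 * k + 4 * i : ℝ) := by
    refine Finset.prod_induction _ (fun y : ℝ => 1 ≤ y) (fun _ _ => one_le_mul_of_one_le_of_one_le)
      le_rfl fun i _ => ?_
    have : (0 : ℝ) ≤ i := by positivity
    linarith
  have h2 : (0 : ℝ) < m.factorial := by positivity
  rw [besselCoeff, abs_div, abs_pow, abs_neg, abs_one, one_pow, abs_of_pos (by positivity)]
  gcongr
  nlinarith

theorem summable_besselProfile {k : ℕ} (hk : 1 ≤ k) (s : ℝ) :
    Summable fun m => besselCoeff k m * s ^ m := by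
  refine Summable.of_norm_bounded (Real.summable_pow_div_factorial |s|) fun m => ?_
  rw [norm_mul, norm_pow, Real.norm_eq_abs, Real.norm_eq_abs]
  calc |besselCoeff k m| * |s| ^ m ≤ 1 / m.factorial * |s| ^ m := by
        gcongr; exact abs_besselCoeff_le hk m
    _ = |s| ^ m / m.factorial := by ring

theorem besselCoeff_zero (k : ℕ) : besselCoeff k 0 = 1 := by simp [besselCoeff]

theorem besselProfile_zero (k : ℕ) : besselProfile k 0 = 1 := by
  rw [besselProfile, tsum_eq_single 0]
  · simp [besselCoeff_zero]
  · intro m hm; simp [hm]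

/-- Termwise differentiation of the series shifts the parameter by `2`. -/
theorem succ_mul_besselCoeff_succ {k : ℕ} (hk : 1 ≤ k) (m : ℕ) :
    (m + 1) * besselCoeff k (m + 1) = -(1 / (2 * k)) * besselCoeff (k + 2) m := by
  have hk' : (1 : ℝ) ≤ k := by exact_mod_cast hk
  have h : ∏ i ∈ Finset.range (m + 1), (2 * k + 4 * i : ℝ) =
      (∏ i ∈ Finset.range m, (2 * (k + 2 : ℕ) + 4 * i : ℝ)) * (2 * k) := by
    rw [Finset.prod_range_succ']
    push_cast
    congr 1
    · apply Finset.prod_congr rfl; intros; ring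
    · ring
  have h3 : (∏ i ∈ Finset.range m, (2 * (k + 2 : ℕ) + 4 * i : ℝ)) ≠ 0 := by
    apply Finset.prod_ne_zero_iff.2; intros; positivity
  rw [besselCoeff, besselCoeff, h, Nat.factorial_succ]
  push_cast at h3 ⊢
  have : (m.factorial : ℝ) ≠ 0 := by positivity
  have : (m + 1 : ℝ) ≠ 0 := by positivity
  field_simp
  ring

theorem hasDerivAt_besselProfile {k : ℕ} (hk : 1 ≤ k) (s : ℝ) :
    HasDerivAt (besselProfile k) (-(1 / (2 * k)) * besselProfile (k + 2) s) s := by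
  have key : HasDerivAt (fun z => ∑' m : ℕ, besselCoeff k m * z ^ m)
      (∑' m : ℕ, besselCoeff k m * (m * s ^ (m - 1))) s := by
    refine hasDerivAt_tsum_of_isPreconnected (u := fun m : ℕ =>
        m * (|s| + 1) ^ (m - 1) / m.factorial) (t := Metric.ball 0 (|s| + 1)) (y₀ := 0)
        ?_ Metric.isOpen_ball (convex_ball (0 : ℝ) _).isPreconnected
        (fun m y _ => (hasDerivAt_pow m y).const_mul (besselCoeff k m)) ?_
        (Metric.mem_ball_self (by positivity)) (summable_besselProfile hk 0)
        (mem_ball_zero_iff.2 (by simp))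
    · rw [← summable_nat_add_iff 1]
      refine (Real.summable_pow_div_factorial (|s| + 1)).congr fun m => ?_
      have : (m.factorial : ℝ) ≠ 0 := by positivity
      rw [Nat.factorial_succ]
      push_cast
      field_simp
    · intro m y hy
      have hy' : |y| ≤ |s| + 1 := by simpa using (Metric.mem_ball.1 hy).le
      rw [norm_mul, norm_mul, norm_pow, Real.norm_eq_abs, Real.norm_eq_abs, Real.norm_eq_abs,
        Nat.abs_cast]
      calc |besselCoeff k m| * (m * |y| ^ (m - 1))
          ≤ 1 / m.factorial * (m * (|s| + 1) ^ (m - 1)) := by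
            gcongr; exact abs_besselCoeff_le hk m
        _ = _ := by ring
  refine key.congr_deriv ?_
  have hs : Summable fun m : ℕ => besselCoeff k m * (m * s ^ (m - 1)) := by
    rw [← summable_nat_add_iff 1]
    refine ((summable_besselProfile (by omega : 1 ≤ k + 2) s).mul_left (-(1 / (2 * k : ℝ)))).congr
      fun m => ?_
    rw [Nat.add_sub_cancel]
    push_cast
    linear_combination -(s ^ m) * succ_mul_besselCoeff_succ hk m
  rw [hs.tsum_eq_zero_add, besselProfile, ← tsum_mul_left]
  simp only [Nat.cast_zero, zero_mul, mul_zero, zero_add]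
  refine tsum_congr fun m => ?_
  rw [Nat.add_sub_cancel]
  push_cast
  linear_combination s ^ m * succ_mul_besselCoeff_succ hk m

theorem continuous_besselProfile {k : ℕ} (hk : 1 ≤ k) : Continuous (besselProfile k) :=
  continuous_iff_continuousAt.2 fun s => (hasDerivAt_besselProfile hk s).continuousAt

/-- The equation `4 s g'' + 2 k g' + g = 0`, with the derivatives written as the profiles with
parameters `k + 2` and `k + 4`. -/
theorem besselProfile_equation {k : ℕ} (hk : 1 ≤ k) (s : ℝ) :
    4 * s * (1 / (2 * k) * (1 / (2 * (k + 2 : ℕ))) * besselProfile (k + 4) s)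
      - besselProfile (k + 2) s + besselProfile k s = 0 := by
  have hk' : (1 : ℝ) ≤ k := by exact_mod_cast hk
  have h0 := summable_besselProfile hk s
  have h2 := summable_besselProfile (by omega : 1 ≤ k + 2) s
  have e0 : besselProfile k s = 1 + ∑' m, besselCoeff k (m + 1) * s ^ (m + 1) := by
    rw [besselProfile, h0.tsum_eq_zero_add, besselCoeff_zero]; simp
  have e2 : besselProfile (k + 2) s = 1 + ∑' m, besselCoeff (k + 2) (m + 1) * s ^ (m + 1) := by
    rw [besselProfile, h2.tsum_eq_zero_add, besselCoeff_zero]; simp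
  have h0' := (summable_nat_add_iff 1).2 h0
  have h2' := (summable_nat_add_iff 1).2 h2
  have e4 : 4 * s * (1 / (2 * k) * (1 / (2 * (k + 2 : ℕ))) * besselProfile (k + 4) s) =
      ∑' m, (besselCoeff (k + 2) (m + 1) * s ^ (m + 1) - besselCoeff k (m + 1) * s ^ (m + 1)) := by
    rw [besselProfile, ← tsum_mul_left, ← tsum_mul_left]
    refine tsum_congr fun m => ?_
    have a1 := succ_mul_besselCoeff_succ (by omega : 1 ≤ k + 2) m
    have a2 := succ_mul_besselCoeff_succ hk m
    have a3 : besselCoeff (k + 2) (m + 1) * ((m + 1) * (2 * k + 4 + 4 * m)) =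
        -besselCoeff (k + 2) m := by
      have : (∏ i ∈ Finset.range m, (2 * (k + 2 : ℕ) + 4 * i : ℝ)) ≠ 0 := by
        apply Finset.prod_ne_zero_iff.2; intros; positivity
      have : (2 * k + 4 + 4 * m : ℝ) ≠ 0 := by positivity
      have : (2 * (k + 2) + 4 * m : ℝ) ≠ 0 := by positivity
      have : (m + 1 : ℝ) ≠ 0 := by positivity
      rw [besselCoeff, besselCoeff, Finset.prod_range_succ, Nat.factorial_succ]
      push_cast at *
      field_simp
      ring
    have hm : (m + 1 : ℝ) ≠ 0 := by positivity
    have b1 : besselCoeff (k + 4) m =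
        -(2 * (k + 2 : ℕ)) * ((m + 1) * besselCoeff (k + 2) (m + 1)) := by
      rw [a1]; field_simp
    have b2 : besselCoeff k (m + 1) =
        (1 / (2 * k)) * (besselCoeff (k + 2) (m + 1) * (2 * k + 4 + 4 * m)) := by
      apply mul_left_cancel₀ hm
      rw [a2, ← neg_eq_iff_eq_neg.2 a3]
      ring
    rw [b1, b2]
    field_simp
    ring
  rw [e4, h2'.tsum_sub h0', e0, e2]
  ring

theorem hasDerivAt_deriv_besselProfile {k : ℕ} (hk : 1 ≤ k) (s : ℝ) :
    HasDerivAt (fun s => -(1 / (2 * k)) * besselProfile (k + 2) s)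
      (1 / (2 * k) * (1 / (2 * (k + 2 : ℕ))) * besselProfile (k + 4) s) s := by
  refine ((hasDerivAt_besselProfile (by omega : 1 ≤ k + 2) s).const_mul
    (-(1 / (2 * k : ℝ)))).congr_deriv ?_
  ring

/-! ### Second derivatives, radial functions and Barta's principle -/

/-- Necessary second-order condition at a local maximum. -/
theorem IsLocalMax.fderiv_fderiv_nonpos {E : Type*} [NormedAddCommGroup E] [NormedSpace ℝ E]
    {f : E → ℝ} {x : E} (h : IsLocalMax f x) (hf : ContDiffAt ℝ 2 f x) (v : E) :
    fderiv ℝ (fderiv ℝ f) x v v ≤ 0 := by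
  by_contra! hd
  set d := fderiv ℝ (fderiv ℝ f) x v v with hd_def
  have hline : ∀ t : ℝ, HasDerivAt (fun t : ℝ => x + t • v) v t := fun t => by
    simpa using ((hasDerivAt_id t).smul_const v).const_add x
  have hc : Filter.Tendsto (fun t : ℝ => x + t • v) (nhds 0) (nhds x) := by
    have := (hline 0).continuousAt.tendsto
    simpa using this
  have hfd : ∀ᶠ y in nhds x, DifferentiableAt ℝ f y := by
    filter_upwards [hf.eventually (by simp)] with y hy
    exact hy.differentiableAt (by simp)
  have hdf : DifferentiableAt ℝ (fderiv ℝ f) x :=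
    (hf.fderiv_right (m := 1) (by norm_num)).differentiableAt (by simp)
  -- Subtracting half of the second-order term keeps the second derivative positive.
  set q : ℝ → ℝ := fun t => f (x + t • v) - d / 4 * t ^ 2 with hq
  have hq1 : deriv q =ᶠ[nhds 0] fun t => fderiv ℝ f (x + t • v) v - d / 2 * t := by
    filter_upwards [hc.eventually hfd] with t ht
    have h1 : HasDerivAt (fun t : ℝ => f (x + t • v)) (fderiv ℝ f (x + t • v) v) t :=
      HasFDerivAt.comp_hasDerivAt (f := fun t : ℝ => x + t • v) t ht.hasFDerivAt (hline t)
    rw [(h1.fun_sub ((hasDerivAt_pow 2 t).const_mul (d / 4))).deriv]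
    norm_num
    ring
  have hq2 : HasDerivAt (fun t : ℝ => fderiv ℝ f (x + t • v) v - d / 2 * t) (d - d / 2) 0 := by
    have h0 : HasFDerivAt (fderiv ℝ f) (fderiv ℝ (fderiv ℝ f) x) (x + (0 : ℝ) • v) := by
      simpa using hdf.hasFDerivAt
    have h1 : HasDerivAt (fun t : ℝ => fderiv ℝ f (x + t • v)) (fderiv ℝ (fderiv ℝ f) x v) 0 :=
      HasFDerivAt.comp_hasDerivAt (f := fun t : ℝ => x + t • v) 0 h0 (hline 0)
    have h2 := (h1.clm_apply (hasDerivAt_const (0 : ℝ) v)).fun_sub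
      ((hasDerivAt_id' (0 : ℝ)).const_mul (d / 2))
    simpa [hd_def] using h2
  have hqc : ContinuousAt q 0 := by
    have : ContinuousAt (fun t : ℝ => f (x + t • v)) 0 := by
      have hx : ContinuousAt f (x + (0 : ℝ) • v) := by simpa using hf.continuousAt
      exact ContinuousAt.comp (f := fun t : ℝ => x + t • v) hx (hline 0).continuousAt
    exact this.sub (by fun_prop)
  have hdq : deriv q 0 = 0 := by
    rw [hq1.eq_of_nhds]; simp [h.fderiv_eq_zero]
  have hmin : IsLocalMin q 0 := by
    apply isLocalMin_of_deriv_deriv_pos _ hdq hqc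
    rw [hq1.deriv_eq, hq2.deriv]; linarith
  have hmax := hc.eventually h
  have hcontra : ∀ᶠ t : ℝ in nhdsWithin 0 {0}ᶜ, False := by
    filter_upwards [nhdsWithin_le_nhds hmin, nhdsWithin_le_nhds hmax, self_mem_nhdsWithin]
      with t h1 h2 h3
    simp only [hq] at h1
    have : 0 < t ^ 2 := by have : t ≠ 0 := h3; positivity
    simp at h1
    nlinarith
  exact hcontra.exists.elim fun _ h => h

theorem ContDiffAt.fderiv_fderiv_sub {E : Type*} [NormedAddCommGroup E] [NormedSpace ℝ E]
    {f g : E → ℝ} {x : E} (hf : ContDiffAt ℝ 2 f x) (hg : ContDiffAt ℝ 2 g x) :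
    fderiv ℝ (fderiv ℝ fun y => f y - g y) x =
      fderiv ℝ (fderiv ℝ f) x - fderiv ℝ (fderiv ℝ g) x := by
  have he : fderiv ℝ (fun y => f y - g y) =ᶠ[nhds x] fun y => fderiv ℝ f y - fderiv ℝ g y := by
    filter_upwards [hf.eventually (by simp), hg.eventually (by simp)] with y h1 h2
    exact fderiv_fun_sub (h1.differentiableAt (by simp)) (h2.differentiableAt (by simp))
  rw [he.fderiv_eq]
  exact fderiv_fun_sub ((hf.fderiv_right (m := 1) (by norm_num)).differentiableAt (by simp))
    ((hg.fderiv_right (m := 1) (by norm_num)).differentiableAt (by simp))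

theorem hessianMatrix_congr {N : ℕ} {f g : EuclideanSpace ℝ (Fin N) → ℝ}
    {x : EuclideanSpace ℝ (Fin N)} (h : f =ᶠ[nhds x] g) :
    hessianMatrix f x = hessianMatrix g x := by
  ext i j
  simp only [hessianMatrix, Matrix.of_apply]
  rw [h.fderiv.fderiv_eq]

theorem dotProduct_hessianMatrix_mulVec {N : ℕ} (f : EuclideanSpace ℝ (Fin N) → ℝ)
    (x v : EuclideanSpace ℝ (Fin N)) :
    (v : Fin N → ℝ) ⬝ᵥ (hessianMatrix f x).mulVec v = fderiv ℝ (fderiv ℝ f) x v v := by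
  have hv : v = ∑ i, v i • EuclideanSpace.single i (1 : ℝ) := by
    ext j; simp [Finset.sum_apply, Pi.single_apply]
  conv_rhs => rw [hv]
  simp only [map_sum, map_smul, sum_apply, smul_apply,
    dotProduct, Matrix.mulVec, hessianMatrix, Matrix.of_apply, smul_eq_mul, Finset.mul_sum]
  rw [Finset.sum_comm]
  refine Finset.sum_congr rfl fun i _ => Finset.sum_congr rfl fun j _ => by ring

theorem laplacian_eq_trace_hessianMatrix {N : ℕ} (f : EuclideanSpace ℝ (Fin N) → ℝ)
    (x : EuclideanSpace ℝ (Fin N)) :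
    Laplacian.laplacian f x = (hessianMatrix f x).trace := by
  rw [InnerProductSpace.laplacian_eq_iteratedFDeriv_orthonormalBasis f
    (EuclideanSpace.basisFun (Fin N) ℝ)]
  simp [Matrix.trace, hessianMatrix, iteratedFDeriv_two_apply]

/-- The Hessian of a radial function written as a function of `|x|²`. -/
theorem hessianMatrix_radial {N : ℕ} {f f' : ℝ → ℝ} {f'' : ℝ} (x : EuclideanSpace ℝ (Fin N))
    (hf : ∀ s, HasDerivAt f (f' s) s) (hf' : HasDerivAt f' f'' (‖x‖ ^ 2)) :
    hessianMatrix (fun y : EuclideanSpace ℝ (Fin N) => f (‖y‖ ^ 2)) x =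
      (2 * f' (‖x‖ ^ 2)) • (1 : Matrix (Fin N) (Fin N) ℝ) +
        (4 * f'') • Matrix.vecMulVec (x : Fin N → ℝ) x := by
  let B : EuclideanSpace ℝ (Fin N) →L[ℝ] EuclideanSpace ℝ (Fin N) →L[ℝ] ℝ := innerSL ℝ
  have hB : ∀ y z, B y z = inner ℝ y z := fun _ _ => rfl
  have h1 : fderiv ℝ (fun y : EuclideanSpace ℝ (Fin N) => f (‖y‖ ^ 2)) =
      fun y => (2 * f' (‖y‖ ^ 2)) • B y := by
    ext1 y
    have := (hf (‖y‖ ^ 2)).comp_hasFDerivAt y (hasStrictFDerivAt_norm_sq y).hasFDerivAt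
    refine (this.fderiv).trans ?_
    ext z; simp [hB]; ring
  have h2 : HasFDerivAt (fun y : EuclideanSpace ℝ (Fin N) => (2 * f' (‖y‖ ^ 2)) • B y)
      ((2 * f' (‖x‖ ^ 2)) • B + ((2 : ℝ) • f'' • ((2 : ℕ) • B x)).smulRight (B x)) x :=
    ((hf'.comp_hasFDerivAt x (hasStrictFDerivAt_norm_sq x).hasFDerivAt).const_mul 2).smul
      B.hasFDerivAt
  ext i j
  simp only [hessianMatrix, Matrix.of_apply, h1]
  rw [h2.fderiv]
  simp [hB, Matrix.vecMulVec_apply, Matrix.one_apply, EuclideanSpace.inner_single_right,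
    PiLp.single_apply, eq_comm]
  ring

theorem laplacian_radial {N : ℕ} {f f' : ℝ → ℝ} {f'' : ℝ} (x : EuclideanSpace ℝ (Fin N))
    (hf : ∀ s, HasDerivAt f (f' s) s) (hf' : HasDerivAt f' f'' (‖x‖ ^ 2)) :
    Laplacian.laplacian (fun y : EuclideanSpace ℝ (Fin N) => f (‖y‖ ^ 2)) x =
      2 * N * f' (‖x‖ ^ 2) + 4 * ‖x‖ ^ 2 * f'' := by
  rw [laplacian_eq_trace_hessianMatrix, hessianMatrix_radial x hf hf', Matrix.trace_add,
    Matrix.trace_smul, Matrix.trace_smul, Matrix.trace_one, Matrix.trace_vecMulVec,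
    EuclideanSpace.real_norm_sq_eq]
  simp [dotProduct, sq]
  ring

/-- Barta's principle: at an interior maximum of `φ / w`, the ratio `Δφ / φ` is at most
`Δw / w`. -/
theorem exists_laplacian_mul_le {N : ℕ} {R : ℝ} {φ w : EuclideanSpace ℝ (Fin N) → ℝ}
    (hφ : ContDiffOn ℝ 2 φ (Metric.ball 0 R)) (hφc : ContinuousOn φ (Metric.closedBall 0 R))
    (hφ0 : ∀ x ∈ Metric.sphere 0 R, φ x ≤ 0) (hφp : ∃ x ∈ Metric.ball 0 R, 0 < φ x)
    (hw : ContDiffOn ℝ 2 w (Metric.ball 0 R)) (hwc : ContinuousOn w (Metric.closedBall 0 R))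
    (hwp : ∀ x ∈ Metric.closedBall 0 R, 0 < w x) :
    ∃ x ∈ Metric.ball 0 R, 0 < φ x ∧
      Laplacian.laplacian φ x * w x ≤ φ x * Laplacian.laplacian w x := by
  obtain ⟨z, hz, hzp⟩ := hφp
  obtain ⟨x, hx, hmax⟩ := (isCompact_closedBall (0 : EuclideanSpace ℝ (Fin N)) R).exists_isMaxOn
    ⟨z, Metric.ball_subset_closedBall hz⟩ (hφc.div hwc fun y hy => (hwp y hy).ne')
  have hwx := hwp x hx
  set t := φ x / w x with ht
  have htp : 0 < t := lt_of_lt_of_le (div_pos hzp (hwp z (Metric.ball_subset_closedBall hz)))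
    (hmax (Metric.ball_subset_closedBall hz))
  have hφx : φ x = t * w x := by rw [ht]; field_simp
  have hφxp : 0 < φ x := by rw [hφx]; positivity
  have hxb : x ∈ Metric.ball 0 R := by
    rcases lt_or_eq_of_le (Metric.mem_closedBall.1 hx) with h | h
    · exact h
    · exact absurd (hφ0 x h) (not_le.2 hφxp)
  have hn := Metric.isOpen_ball.mem_nhds hxb
  have c1 := hφ.contDiffAt hn
  have c2 : ContDiffAt ℝ 2 (fun y => t * w y) x := contDiffAt_const.mul (hw.contDiffAt hn)
  have hloc : IsLocalMax (fun y => φ y - t * w y) x := by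
    filter_upwards [hn] with y hy
    have hy' := Metric.ball_subset_closedBall hy
    have h1 : φ y / w y ≤ t := hmax hy'
    rw [div_le_iff₀ (hwp y hy')] at h1
    linarith
  have hle : Laplacian.laplacian φ x ≤ t * Laplacian.laplacian w x := by
    have e : (fun y => t * w y) = t • w := rfl
    have e2 : t * Laplacian.laplacian w x = Laplacian.laplacian (fun y => t * w y) x := by
      rw [e, InnerProductSpace.laplacian_smul _ (hw.contDiffAt hn)]; rfl
    rw [e2, laplacian_eq_trace_hessianMatrix, laplacian_eq_trace_hessianMatrix]
    refine Finset.sum_le_sum fun i _ => ?_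
    have := hloc.fderiv_fderiv_nonpos (c1.sub c2) (EuclideanSpace.single i 1)
    rw [c1.fderiv_fderiv_sub c2] at this
    simpa [hessianMatrix] using this
  refine ⟨x, hxb, hφxp, ?_⟩
  calc _ ≤ t * Laplacian.laplacian w x * w x := by gcongr
    _ = _ := by rw [hφx]; ring

/-! ### Truncated Laplacians of matrices `a I + b x xᵀ` -/

open Classical in
/-- The truncated Laplacian as a sum over orthonormal eigenvectors: there is an orthonormal basis
`e` of eigenvectors, with eigenvalues `l` sorted in nonincreasing order. -/
theorem exists_orthonormalBasis_truncatedPlus {N : ℕ} {X : Matrix (Fin N) (Fin N) ℝ}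
    (hX : X.IsHermitian) :
    ∃ (e : OrthonormalBasis (Fin N) ℝ (EuclideanSpace ℝ (Fin N))) (l : Fin N → ℝ),
      Antitone l ∧ (∀ i, X.mulVec (e i) = l i • (e i : Fin N → ℝ)) ∧
        ∀ k, truncatedPlus k X = ∑ i : Fin N with i.val < k, l i := by
  let c : Fin N ≃o Fin (Fintype.card (Fin N)) := Fin.castOrderIso (Fintype.card_fin N).symm
  let d : Fin (Fintype.card (Fin N)) ≃ Fin N := Fintype.equivOfCardEq (Fintype.card_fin _)
  refine ⟨hX.eigenvectorBasis.reindex (d.symm.trans c.symm.toEquiv), fun i => hX.eigenvalues₀ (c i),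
    fun i j hij => hX.eigenvalues₀_antitone (c.monotone hij), fun i => ?_, fun k => ?_⟩
  · have := hX.mulVec_eigenvectorBasis (d (c i))
    simpa [Matrix.IsHermitian.eigenvalues, d] using this
  · rw [truncatedPlus, dif_pos hX]
    refine (Finset.sum_equiv c.toEquiv (fun i => ?_) fun i _ => rfl).symm
    simp [c]

theorem card_filter_val_lt {N k : ℕ} (hkN : k ≤ N) :
    (Finset.univ.filter fun i : Fin N => i.val < k).card = k := by
  rw [Fin.card_filter_val_lt]; omega

/-- If `X ≤ a I + b x xᵀ` with `b ≥ 0`, then `P⁺ₖ(X) ≤ k a + b |x|²`: evaluate the quadratic form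
on the first `k` eigenvectors and apply Bessel's inequality to `x`. -/
theorem truncatedPlus_le {N k : ℕ} (hkN : k ≤ N) {X : Matrix (Fin N) (Fin N) ℝ}
    (hX : X.IsHermitian) {a b : ℝ} (hb : 0 ≤ b) (x : EuclideanSpace ℝ (Fin N))
    (h : ∀ v : EuclideanSpace ℝ (Fin N),
      (v : Fin N → ℝ) ⬝ᵥ X.mulVec v ≤ a * ‖v‖ ^ 2 + b * inner ℝ v x ^ 2) :
    truncatedPlus k X ≤ k * a + b * ‖x‖ ^ 2 := by
  obtain ⟨e, l, -, he, hP⟩ := exists_orthonormalBasis_truncatedPlus hX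
  have hl : ∀ i, l i ≤ a + b * inner ℝ (e i) x ^ 2 := fun i => by
    have h1 := h (e i)
    have h2 : (e i : Fin N → ℝ) ⬝ᵥ (e i : Fin N → ℝ) = 1 := by
      have := e.orthonormal.1 i
      have h3 := EuclideanSpace.real_norm_sq_eq (e i)
      rw [this] at h3
      simp only [dotProduct, ← sq]
      rw [← h3]; norm_num
    rw [he, dotProduct_smul, h2, e.orthonormal.1 i] at h1
    simpa using h1
  rw [hP]
  calc _ ≤ ∑ i : Fin N with i.val < k, (a + b * inner ℝ (e i) x ^ 2) :=
        Finset.sum_le_sum fun i _ => hl i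
    _ = k * a + b * ∑ i : Fin N with i.val < k, inner ℝ (e i) x ^ 2 := by
        rw [Finset.sum_add_distrib, Finset.sum_const, card_filter_val_lt hkN, Finset.mul_sum,
          nsmul_eq_mul]
    _ ≤ _ := by
        gcongr
        simpa using e.orthonormal.sum_inner_products_le (x := x)
          (s := Finset.univ.filter fun i : Fin N => i.val < k)

theorem smul_one_add_smul_vecMulVec_mulVec {N : ℕ} (a b : ℝ) (x v : EuclideanSpace ℝ (Fin N)) :
    (a • (1 : Matrix (Fin N) (Fin N) ℝ) + b • Matrix.vecMulVec (x : Fin N → ℝ) x).mulVec v =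
      a • (v : Fin N → ℝ) + (b * inner ℝ v x) • (x : Fin N → ℝ) := by
  ext i
  simp [Matrix.add_mulVec, Matrix.smul_mulVec, Matrix.vecMulVec_mulVec,
    EuclideanSpace.inner_eq_star_dotProduct]
  ring

theorem dotProduct_smul_one_add_smul_vecMulVec_mulVec {N : ℕ} (a b : ℝ)
    (x v : EuclideanSpace ℝ (Fin N)) :
    (v : Fin N → ℝ) ⬝ᵥ
      (a • (1 : Matrix (Fin N) (Fin N) ℝ) + b • Matrix.vecMulVec (x : Fin N → ℝ) x).mulVec v =
      a * ‖v‖ ^ 2 + b * inner ℝ v x ^ 2 := by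
  rw [smul_one_add_smul_vecMulVec_mulVec, dotProduct_add, dotProduct_smul, dotProduct_smul,
    EuclideanSpace.real_norm_sq_eq, EuclideanSpace.inner_eq_star_dotProduct]
  simp [dotProduct_comm (x : Fin N → ℝ) v]
  simp [dotProduct, ← sq]
  ring

theorem isHermitian_smul_one_add_smul_vecMulVec {N : ℕ} (a b : ℝ) (x : Fin N → ℝ) :
    (a • (1 : Matrix (Fin N) (Fin N) ℝ) + b • Matrix.vecMulVec x x).IsHermitian := by
  ext i j
  simp [Matrix.vecMulVec_apply, Matrix.one_apply, eq_comm, mul_comm]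

/-- For `b ≥ 0` the eigenvalues of `a I + b x xᵀ` are `a + b |x|²`, followed by `a` with
multiplicity `N - 1`. -/
theorem truncatedPlus_smul_one_add_smul_vecMulVec {N k : ℕ} (hk : 1 ≤ k) (hkN : k ≤ N) (a : ℝ)
    {b : ℝ} (hb : 0 ≤ b) (x : EuclideanSpace ℝ (Fin N)) :
    truncatedPlus k
      (a • (1 : Matrix (Fin N) (Fin N) ℝ) + b • Matrix.vecMulVec (x : Fin N → ℝ) x) =
      k * a + b * ‖x‖ ^ 2 := by
  have hX := isHermitian_smul_one_add_smul_vecMulVec a b (x : Fin N → ℝ)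
  apply le_antisymm
  · exact truncatedPlus_le hkN hX hb x fun v =>
      (dotProduct_smul_one_add_smul_vecMulVec_mulVec a b x v).le
  obtain ⟨e, l, hl, he, hP⟩ := exists_orthonormalBasis_truncatedPlus hX
  have hij : ∀ i j, inner ℝ (e i) (e j) = if i = j then (1 : ℝ) else 0 :=
    orthonormal_iff_ite.1 e.orthonormal
  -- The component of the eigenvector equation along each `e j`.
  have hcomp : ∀ i j, (l i - a) * inner ℝ (e i) (e j) =
      b * inner ℝ (e i) x * inner ℝ (e j) x := fun i j => by
    have h1 : (e j : Fin N → ℝ) ⬝ᵥ _ = (e j : Fin N → ℝ) ⬝ᵥ _ := congrArg _ (he i)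
    rw [smul_one_add_smul_vecMulVec_mulVec, dotProduct_add, dotProduct_smul, dotProduct_smul,
      dotProduct_smul] at h1
    have h2 : ∀ y z : EuclideanSpace ℝ (Fin N), (y : Fin N → ℝ) ⬝ᵥ (z : Fin N → ℝ) =
        inner ℝ y z := fun y z => by
      rw [EuclideanSpace.inner_eq_star_dotProduct, dotProduct_comm]; simp
    rw [h2, h2] at h1
    simp only [smul_eq_mul] at h1
    rw [real_inner_comm (e j) (e i)] at *
    linarith
  have hdiag : ∀ i, l i = a + b * inner ℝ (e i) x ^ 2 := fun i => by
    have := hcomp i i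
    rw [hij, if_pos rfl] at this
    linarith
  have htail : ∀ i : Fin N, ¬ i.val < k → b * inner ℝ (e i) x ^ 2 = 0 := fun i hi => by
    let i₀ : Fin N := ⟨0, by omega⟩
    have hne : i ≠ i₀ := fun h => hi (by rw [h]; exact hk)
    have h1 := hcomp i i₀
    rw [hij, if_neg hne, mul_zero] at h1
    have h2 : l i ≤ l i₀ := hl (Fin.mk_le_of_le_val (Nat.zero_le _))
    rw [hdiag i, hdiag i₀] at h2
    have h3 : 0 ≤ b * inner ℝ (e i) x ^ 2 := by positivity
    have h4 : (b * inner ℝ (e i) x ^ 2) * (b * inner ℝ (e i₀) x ^ 2) = 0 := by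
      linear_combination (-(b * inner ℝ (e i) x * inner ℝ (e i₀) x)) * h1
    rcases mul_eq_zero.1 h4 with h | h
    · exact h
    · linarith
  rw [hP, Finset.sum_congr rfl fun i _ => hdiag i, Finset.sum_add_distrib, Finset.sum_const,
    card_filter_val_lt hkN, nsmul_eq_mul, ← e.sum_sq_norm_inner_right x, Finset.mul_sum,
    ← Finset.sum_filter_add_sum_filter_not Finset.univ (fun i : Fin N => i.val < k)]
  rw [Finset.sum_eq_zero (s := Finset.univ.filter fun i : Fin N => ¬ i.val < k)]
  · simp
  · intro i hi
    simpa using htail i (Finset.mem_filter.1 hi).2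

/-! ### The first zero of the profile -/

theorem exists_first_zero {f : ℝ → ℝ} (hf : Continuous f) (h0 : 0 < f 0) {b : ℝ} (hb : 0 ≤ b)
    (hfb : f b ≤ 0) : ∃ z, 0 < z ∧ z ≤ b ∧ f z = 0 ∧ ∀ s, 0 ≤ s → s < z → 0 < f s := by
  set S : Set ℝ := Set.Icc 0 b ∩ f ⁻¹' {0} with hS
  have hne : S.Nonempty := by
    obtain ⟨z, hz, hz0⟩ := intermediate_value_Icc' hb hf.continuousOn ⟨hfb, h0.le⟩
    exact ⟨z, hz, hz0⟩
  have hc : IsCompact S := isCompact_Icc.inter_right (isClosed_singleton.preimage hf)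
  obtain ⟨z, ⟨hzI, hz0⟩, hz⟩ := hc.exists_isLeast hne
  have hz0 : f z = 0 := hz0
  refine ⟨z, lt_of_le_of_ne hzI.1 ?_, hzI.2, hz0, fun s hs hsz => ?_⟩
  · rintro rfl
    exact h0.ne' hz0
  · by_contra! hneg
    obtain ⟨y, hy, hy0⟩ := intermediate_value_Icc' hs hf.continuousOn ⟨hneg, h0.le⟩
    exact absurd (hz ⟨⟨hy.1, (hy.2.trans hsz.le).trans hzI.2⟩, hy0⟩)
      (not_le.2 (hy.2.trans_lt hsz))

/-- As long as the profile with parameter `k` stays positive, so does the one with parameter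
`k + 2`: at a first zero of `g' = -g_{k+2} / (2k)` the equation would give `g'' < 0`, although
`g'` reaches the value `0` from below. -/
theorem besselProfile_add_two_pos {k : ℕ} (hk : 1 ≤ k) {a : ℝ}
    (h : ∀ s, 0 ≤ s → s < a → 0 < besselProfile k s) {s : ℝ} (hs : 0 ≤ s) (hsa : s < a) :
    0 < besselProfile (k + 2) s := by
  by_contra! hneg
  have hk2 : 1 ≤ k + 2 := by omega
  have hk' : (1 : ℝ) ≤ k := by exact_mod_cast hk
  obtain ⟨z, hz, hzs, hz0, hpos⟩ := exists_first_zero (continuous_besselProfile hk2)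
    (by rw [besselProfile_zero]; norm_num) hs hneg
  have hgz := h z hz.le (hzs.trans_lt hsa)
  have heq := besselProfile_equation hk z
  rw [hz0] at heq
  have hg4 : besselProfile (k + 4) z < 0 := by
    by_contra! h4
    have : 0 ≤ 4 * z * (1 / (2 * k) * (1 / (2 * (k + 2 : ℕ))) * besselProfile (k + 4) z) := by
      positivity
    linarith
  have hd := hasDerivAt_besselProfile hk2 z
  set d := -(1 / (2 * ((k + 2 : ℕ) : ℝ))) * besselProfile (k + 2 + 2) z with hd_def
  have hdpos : 0 < d := by
    have : (0 : ℝ) < 1 / (2 * ((k + 2 : ℕ) : ℝ)) := by positivity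
    rw [hd_def]; nlinarith [show besselProfile (k + 2 + 2) z < 0 from hg4]
  have hslope := (hasDerivAt_iff_tendsto_slope_left_right.1 hd).1
  have hev := hslope.eventually (lt_mem_nhds hdpos)
  have hev2 : ∀ᶠ y in nhdsWithin z (Set.Iio z), 0 < y := nhdsWithin_le_nhds (lt_mem_nhds hz)
  obtain ⟨y, hy1, hy2, hy3⟩ := (hev.and (hev2.and self_mem_nhdsWithin)).exists
  have hyz : y < z := hy3
  rw [slope_def_field, hz0] at hy1
  have hgy := hpos y hy2.le hyz
  have : (0 - besselProfile (k + 2) y) / (z - y) < 0 :=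
    div_neg_of_neg_of_pos (by linarith) (by linarith)
  have e : (besselProfile (k + 2) y - 0) / (y - z) = (0 - besselProfile (k + 2) y) / (z - y) := by
    rw [← neg_sub z y, ← neg_sub 0 (besselProfile (k + 2) y), neg_div_neg_eq]
  rw [e] at hy1
  linarith

/-! ### Radial functions built from the profile -/

/-- The radial function `x ↦ c g(μ |x|²)` on `ℝᴺ`, with `g` the profile of parameter `k`. -/
noncomputable def besselRadial (k N : ℕ) (c μ : ℝ) (x : EuclideanSpace ℝ (Fin N)) : ℝ :=
  c * besselProfile k (μ * ‖x‖ ^ 2)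

theorem contDiff_besselProfile (n : ℕ) : ∀ {k : ℕ}, 1 ≤ k → ContDiff ℝ n (besselProfile k) := by
  induction n with
  | zero => exact fun hk => contDiff_zero.2 (continuous_besselProfile hk)
  | succ n ih =>
    intro k hk
    push_cast
    refine contDiff_succ_iff_deriv.2
      ⟨fun s => (hasDerivAt_besselProfile hk s).differentiableAt, by simp, ?_⟩
    rw [funext fun s => (hasDerivAt_besselProfile hk s).deriv]
    exact contDiff_const.mul (ih (by omega))

theorem contDiff_besselRadial {k : ℕ} (hk : 1 ≤ k) (N : ℕ) (c μ : ℝ) :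
    ContDiff ℝ 2 (besselRadial k N c μ) :=
  contDiff_const.mul ((contDiff_besselProfile 2 hk).comp (contDiff_const.mul (contDiff_norm_sq ℝ)))

theorem hasDerivAt_besselProfile_scaled {k : ℕ} (hk : 1 ≤ k) (c μ s : ℝ) :
    HasDerivAt (fun s => c * besselProfile k (μ * s))
      (c * μ * (-(1 / (2 * k)) * besselProfile (k + 2) (μ * s))) s := by
  have h := (hasDerivAt_besselProfile hk (μ * s)).comp s ((hasDerivAt_id' s).const_mul μ)
  exact (h.const_mul c).congr_deriv (by ring)

theorem hasDerivAt_deriv_besselProfile_scaled {k : ℕ} (hk : 1 ≤ k) (c μ s : ℝ) :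
    HasDerivAt (fun s => c * μ * (-(1 / (2 * k)) * besselProfile (k + 2) (μ * s)))
      (c * μ ^ 2 * (1 / (2 * k) * (1 / (2 * (k + 2 : ℕ))) * besselProfile (k + 4) (μ * s))) s := by
  have h := (hasDerivAt_deriv_besselProfile hk (μ * s)).comp s ((hasDerivAt_id' s).const_mul μ)
  exact (h.const_mul (c * μ)).congr_deriv (by ring)

/-- The equation `k (2 f') + 4 s f'' = -μ f` for the scaled profile `f s = c g (μ s)`. The left-hand
side is both the Laplacian in `ℝᵏ` and, if `f'' ≥ 0`, the operator `P⁺ₖ` in `ℝᴺ`, applied to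
`f (|x|²)`. -/
theorem besselProfile_scaled_equation {k : ℕ} (hk : 1 ≤ k) (c μ s : ℝ) :
    k * (2 * (c * μ * (-(1 / (2 * k)) * besselProfile (k + 2) (μ * s)))) +
      4 * (c * μ ^ 2 * (1 / (2 * k) * (1 / (2 * (k + 2 : ℕ))) *
        besselProfile (k + 4) (μ * s))) * s = -μ * (c * besselProfile k (μ * s)) := by
  have hk' : (k : ℝ) ≠ 0 := by positivity
  have h := besselProfile_equation hk (μ * s)
  have h1 : 2 * (k : ℝ) * (1 / (2 * k)) = 1 := by field_simp
  linear_combination c * μ * h - c * μ * besselProfile (k + 2) (μ * s) * h1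

theorem laplacian_besselRadial {k : ℕ} (hk : 1 ≤ k) (c μ : ℝ) (x : EuclideanSpace ℝ (Fin k)) :
    Laplacian.laplacian (besselRadial k k c μ) x = -μ * besselRadial k k c μ x := by
  have e := laplacian_radial x (hasDerivAt_besselProfile_scaled hk c μ)
    (hasDerivAt_deriv_besselProfile_scaled hk c μ (‖x‖ ^ 2))
  refine e.trans ?_
  rw [besselRadial, ← besselProfile_scaled_equation hk c μ (‖x‖ ^ 2)]
  ring

theorem hessianMatrix_besselRadial {k : ℕ} (hk : 1 ≤ k) {N : ℕ} (c μ : ℝ)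
    (x : EuclideanSpace ℝ (Fin N)) :
    hessianMatrix (besselRadial k N c μ) x =
      (2 * (c * μ * (-(1 / (2 * k)) * besselProfile (k + 2) (μ * ‖x‖ ^ 2)))) •
          (1 : Matrix (Fin N) (Fin N) ℝ) +
        (4 * (c * μ ^ 2 * (1 / (2 * k) * (1 / (2 * (k + 2 : ℕ))) *
          besselProfile (k + 4) (μ * ‖x‖ ^ 2)))) • Matrix.vecMulVec (x : Fin N → ℝ) x :=
  hessianMatrix_radial x (hasDerivAt_besselProfile_scaled hk c μ)
    (hasDerivAt_deriv_besselProfile_scaled hk c μ (‖x‖ ^ 2))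

/-- The Hessian of a radial function has eigenvalues `2f' + 4|x|²f''` (once) and `2f'`. When
`f'' ≥ 0` the former is the largest, and `P⁺ₖ` in `ℝᴺ` agrees with the Laplacian in `ℝᵏ`. -/
theorem truncatedPlus_besselRadial {N k : ℕ} (hk : 1 ≤ k) (hkN : k ≤ N) {c μ : ℝ} (hc : 0 ≤ c)
    (x : EuclideanSpace ℝ (Fin N)) (hx : 0 ≤ besselProfile (k + 4) (μ * ‖x‖ ^ 2)) :
    truncatedPlus k (hessianMatrix (besselRadial k N c μ) x) = -μ * besselRadial k N c μ x := by
  rw [hessianMatrix_besselRadial hk,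
    truncatedPlus_smul_one_add_smul_vecMulVec hk hkN _ (by positivity)]
  exact besselProfile_scaled_equation hk c μ (‖x‖ ^ 2)

/-- The Hessian of a smaller touching function has a smaller truncated Laplacian. -/
theorem truncatedPlus_le_besselRadial {N k : ℕ} (hk : 1 ≤ k) (hkN : k ≤ N) {c μ : ℝ} (hc : 0 ≤ c)
    {x : EuclideanSpace ℝ (Fin N)} (hx : 0 ≤ besselProfile (k + 4) (μ * ‖x‖ ^ 2))
    {ψ : EuclideanSpace ℝ (Fin N) → ℝ} (hψ : ContDiffAt ℝ 2 ψ x)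
    (hmin : IsLocalMin (fun y => besselRadial k N c μ y - ψ y) x) :
    truncatedPlus k (hessianMatrix ψ x) ≤ -μ * besselRadial k N c μ x := by
  have hu : ContDiffAt ℝ 2 (besselRadial k N c μ) x := (contDiff_besselRadial hk N c μ).contDiffAt
  have hmax : IsLocalMax (fun y => ψ y - besselRadial k N c μ y) x := by
    filter_upwards [hmin] with y hy
    linarith
  refine (truncatedPlus_le hkN (hessianMatrix_isHermitian hψ)
    (b := 4 * (c * μ ^ 2 * (1 / (2 * k) * (1 / (2 * (k + 2 : ℕ))) *
        besselProfile (k + 4) (μ * ‖x‖ ^ 2)))) (by positivity) x fun v => ?_).trans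
    (besselProfile_scaled_equation hk c μ (‖x‖ ^ 2)).le
  rw [← dotProduct_smul_one_add_smul_vecMulVec_mulVec, ← hessianMatrix_besselRadial hk,
    dotProduct_hessianMatrix_mulVec, dotProduct_hessianMatrix_mulVec]
  have := hmax.fderiv_fderiv_nonpos (hψ.sub hu) v
  rw [hψ.fderiv_fderiv_sub hu] at this
  simpa using this

/-- The profile has a first positive zero. Otherwise `g(|x|²)` would be positive on all of `ℝᵏ`,
which Barta's principle excludes by comparison with `(L - |x|²)²` on a large ball. -/
theorem exists_besselProfile_first_zero {k : ℕ} (hk : 1 ≤ k) :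
    ∃ Z, 0 < Z ∧ besselProfile k Z = 0 ∧ ∀ s, 0 ≤ s → s < Z → 0 < besselProfile k s := by
  by_cases h : ∃ b, 0 ≤ b ∧ besselProfile k b ≤ 0
  · obtain ⟨b, hb, hb0⟩ := h
    obtain ⟨z, hz, -, h⟩ := exists_first_zero (continuous_besselProfile hk)
      (by rw [besselProfile_zero]; norm_num) hb hb0
    exact ⟨z, hz, h⟩
  push Not at h
  exfalso
  -- With `d = L - |x|²`, the function `d²` has `Δ(d²) + d² = d² - (8 + 4k) d + 8L`, a polynomial
  -- in `d` without real zeros for `L = R²`, `R = k + 2`.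
  set R : ℝ := k + 2 with hR
  have hRpos : 0 < R := by positivity
  set φ : EuclideanSpace ℝ (Fin k) → ℝ := fun x => (R ^ 2 - ‖x‖ ^ 2) ^ 2 with hφ
  have hφs : ContDiff ℝ 2 φ := (contDiff_const.sub (contDiff_norm_sq ℝ)).pow 2
  have hw := contDiff_besselRadial hk k 1 1
  obtain ⟨x, -, hx, hle⟩ := exists_laplacian_mul_le (R := R) hφs.contDiffOn
    hφs.continuous.continuousOn
    (fun x hx => by rw [mem_sphere_zero_iff_norm] at hx; simp [hφ, hx])
    ⟨0, Metric.mem_ball_self hRpos, by simp [hφ]; positivity⟩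
    hw.contDiffOn hw.continuous.continuousOn
    (fun x _ => by simpa [besselRadial] using h (‖x‖ ^ 2) (by positivity))
  have hlap : Laplacian.laplacian φ x = 8 * ‖x‖ ^ 2 - 4 * k * (R ^ 2 - ‖x‖ ^ 2) := by
    have h1 : ∀ s : ℝ, HasDerivAt (fun s => (R ^ 2 - s) ^ 2) (-2 * (R ^ 2 - s)) s := fun s =>
      (((hasDerivAt_id' s).const_sub (R ^ 2)).pow 2).congr_deriv (by norm_num)
    have h2 : HasDerivAt (fun s : ℝ => -2 * (R ^ 2 - s)) 2 (‖x‖ ^ 2) :=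
      (((hasDerivAt_id' _).const_sub (R ^ 2)).const_mul (-2)).congr_deriv (by norm_num)
    refine (laplacian_radial x h1 h2).trans ?_
    ring
  have hwx : 0 < besselRadial k k 1 1 x := by
    simpa [besselRadial] using h (‖x‖ ^ 2) (by positivity)
  rw [laplacian_besselRadial hk, hlap] at hle
  have : 8 * ‖x‖ ^ 2 - 4 * k * (R ^ 2 - ‖x‖ ^ 2) ≤ -φ x := by
    apply le_of_mul_le_mul_right _ hwx
    linarith
  simp only [hφ] at this
  have hkR : (k : ℝ) = R - 2 := by rw [hR]; ring
  rw [hkR] at this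
  nlinarith [sq_nonneg ((R ^ 2 - ‖x‖ ^ 2) - 2 * R), sq_pos_of_pos hRpos]

/-! ### The Dirichlet problem for the Laplacian in a ball -/

/-- A maximum principle: below the first eigenvalue `Z / r²` of the ball of radius `r`, solutions
of `Δφ + μφ = 0` with zero boundary values are nonpositive, hence vanish. The comparison function
is `x ↦ g (μ' |x|²)` with `μ < μ' < Z / r²`, which is positive up to the boundary. -/
theorem nonpos_of_laplacian_eq {k : ℕ} (hk : 1 ≤ k) {Z : ℝ} (hZ : 0 < Z)
    (hpos : ∀ s, 0 ≤ s → s < Z → 0 < besselProfile k s) {r μ : ℝ} (hr : 0 < r)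
    (hμ : μ < Z / r ^ 2) {φ : EuclideanSpace ℝ (Fin k) → ℝ}
    (hφ : ContDiffOn ℝ 2 φ (Metric.ball 0 r)) (hφc : ContinuousOn φ (Metric.closedBall 0 r))
    (heq : ∀ x ∈ Metric.ball 0 r, Laplacian.laplacian φ x + μ * φ x = 0)
    (hb : ∀ x ∈ Metric.sphere 0 r, φ x = 0) : ∀ x ∈ Metric.ball 0 r, φ x ≤ 0 := by
  by_contra! hne
  obtain ⟨μ', h1, h2⟩ := exists_between (max_lt hμ (show 0 < Z / r ^ 2 by positivity))
  obtain ⟨h1, h0⟩ := max_lt_iff.1 h1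
  have hw := contDiff_besselRadial hk k 1 μ'
  have hwp : ∀ x ∈ Metric.closedBall (0 : EuclideanSpace ℝ (Fin k)) r,
      0 < besselRadial k k 1 μ' x := fun x hx => by
    rw [mem_closedBall_zero_iff] at hx
    rw [besselRadial, one_mul]
    refine hpos _ (by positivity) ?_
    rw [lt_div_iff₀ (by positivity)] at h2
    refine lt_of_le_of_lt ?_ h2
    gcongr
  obtain ⟨x, hx, hxp, hle⟩ := exists_laplacian_mul_le hφ hφc (fun x hx => (hb x hx).le) hne
    hw.contDiffOn hw.continuous.continuousOn hwp
  rw [laplacian_besselRadial hk, eq_neg_of_add_eq_zero_left (heq x hx)] at hle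
  have := mul_pos hxp (hwp x (Metric.ball_subset_closedBall hx))
  nlinarith

theorem isDirichletEigenfunction_besselRadial {k : ℕ} (hk : 1 ≤ k) {Z : ℝ}
    (hZ0 : besselProfile k Z = 0) {ρ : ℝ} (hρ : 0 < ρ) :
    IsDirichletEigenfunction (Metric.ball 0 ρ) (Z / ρ ^ 2) (besselRadial k k 1 (Z / ρ ^ 2)) where
  contDiffOn := (contDiff_besselRadial hk k _ _).contDiffOn
  continuousOn := (contDiff_besselRadial hk k _ _).continuous.continuousOn
  nontrivial := ⟨0, Metric.mem_ball_self hρ, by simp [besselRadial, besselProfile_zero]⟩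
  equation x _ := by rw [laplacian_besselRadial hk]; ring
  boundary x hx := by
    rw [frontier_ball _ hρ.ne', mem_sphere_zero_iff_norm] at hx
    rw [besselRadial, hx, div_mul_cancel₀ _ (by positivity), hZ0, mul_zero]

theorem isLeast_dirichlet_eigenvalues {k : ℕ} (hk : 1 ≤ k) {Z : ℝ} (hZ : 0 < Z)
    (hZ0 : besselProfile k Z = 0) (hpos : ∀ s, 0 ≤ s → s < Z → 0 < besselProfile k s) {ρ : ℝ}
    (hρ : 0 < ρ) :
    IsLeast {μ : ℝ | ∃ φ : EuclideanSpace ℝ (Fin k) → ℝ,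
      IsDirichletEigenfunction (Metric.ball 0 ρ) μ φ} (Z / ρ ^ 2) := by
  refine ⟨⟨_, isDirichletEigenfunction_besselRadial hk hZ0 hρ⟩, ?_⟩
  rintro μ ⟨φ, hφ⟩
  by_contra! hμ
  have hc := hφ.continuousOn
  have hb := hφ.boundary
  rw [closure_ball _ hρ.ne'] at hc
  rw [frontier_ball _ hρ.ne'] at hb
  obtain ⟨x, hx, hne⟩ := hφ.nontrivial
  have h1 := nonpos_of_laplacian_eq hk hZ hpos hρ hμ hφ.contDiffOn hc hφ.equation hb x hx
  have h2 := nonpos_of_laplacian_eq hk hZ hpos hρ hμ (φ := -φ) hφ.contDiffOn.neg hc.neg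
    (fun y hy => by
      rw [InnerProductSpace.laplacian_neg]
      have := hφ.equation y hy
      simp only [Pi.neg_apply]; linarith)
    (fun y hy => by simp [hb y hy]) x hx
  exact hne (le_antisymm h1 (by simpa using h2))

/-- Radial first eigenfunctions are multiples of `y ↦ g (Z |y|² / ρ²)`. For `r < ρ` pick the
multiple that agrees with `v` on the sphere of radius `r`: the difference solves a Dirichlet
problem in a ball whose first eigenvalue is larger, hence it vanishes there, and evaluating at the
centre shows that the multiple does not depend on `r`. -/
theorem radial_eigenfunction_eq {k : ℕ} (hk : 1 ≤ k) {Z : ℝ} (hZ : 0 < Z)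
    (hZ0 : besselProfile k Z = 0) (hpos : ∀ s, 0 ≤ s → s < Z → 0 < besselProfile k s) {ρ : ℝ}
    (hρ : 0 < ρ) {v : ℝ → ℝ}
    (hv : IsDirichletEigenfunction (Metric.ball (0 : EuclideanSpace ℝ (Fin k)) ρ) (Z / ρ ^ 2)
      fun y => v ‖y‖) {r : ℝ} (hr : 0 ≤ r) (hrρ : r ≤ ρ) :
    v r = v 0 * besselProfile k (Z / ρ ^ 2 * r ^ 2) := by
  rcases hrρ.eq_or_lt with rfl | hlt
  · have := hv.boundary (EuclideanSpace.single ⟨0, hk⟩ r)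
      (by rw [frontier_ball _ hρ.ne']; simp [abs_of_pos hρ])
    simp only [PiLp.norm_single, Real.norm_eq_abs, abs_of_pos hρ] at this
    rw [this, div_mul_cancel₀ _ (by positivity), hZ0, mul_zero]
  rcases hr.eq_or_lt with rfl | hr0
  · simp [besselProfile_zero]
  have hg : 0 < besselProfile k (Z / ρ ^ 2 * r ^ 2) := by
    refine hpos _ (by positivity) ?_
    rw [div_mul_eq_mul_div, div_lt_iff₀ (by positivity)]
    gcongr
  set c := v r / besselProfile k (Z / ρ ^ 2 * r ^ 2) with hc
  have hvr : v r = c * besselProfile k (Z / ρ ^ 2 * r ^ 2) :=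
    (div_mul_cancel₀ _ hg.ne').symm
  have hμ : Z / ρ ^ 2 < Z / r ^ 2 := by gcongr
  have hw := contDiff_besselRadial hk k c (Z / ρ ^ 2)
  have hsub : Metric.ball (0 : EuclideanSpace ℝ (Fin k)) r ⊆ Metric.ball 0 ρ :=
    Metric.ball_subset_ball hlt.le
  have hcl := hv.continuousOn
  rw [closure_ball _ hρ.ne'] at hcl
  have hcl := hcl.mono (Metric.closedBall_subset_closedBall hlt.le)
  have hbd : ∀ x ∈ Metric.sphere (0 : EuclideanSpace ℝ (Fin k)) r,
      v ‖x‖ = besselRadial k k c (Z / ρ ^ 2) x := fun x hx => by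
    rw [mem_sphere_zero_iff_norm] at hx
    rw [besselRadial, hx, hvr]
  have hC : ∀ x ∈ Metric.ball (0 : EuclideanSpace ℝ (Fin k)) r,
      ContDiffAt ℝ 2 (fun y : EuclideanSpace ℝ (Fin k) => v ‖y‖) x := fun x hx =>
    hv.contDiffOn.contDiffAt (Metric.isOpen_ball.mem_nhds (hsub hx))
  have h1 := nonpos_of_laplacian_eq hk hZ hpos hr0 hμ
    (φ := (fun y => v ‖y‖) - besselRadial k k c (Z / ρ ^ 2))
    ((hv.contDiffOn.mono hsub).sub hw.contDiffOn) (hcl.sub hw.continuous.continuousOn)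
    (fun x hx => by
      rw [(hC x hx).laplacian_sub hw.contDiffAt, laplacian_besselRadial hk, Pi.sub_apply]
      linear_combination hv.equation x (hsub hx))
    (fun x hx => by simp [hbd x hx]) 0 (Metric.mem_ball_self hr0)
  have h2 := nonpos_of_laplacian_eq hk hZ hpos hr0 hμ
    (φ := besselRadial k k c (Z / ρ ^ 2) - fun y => v ‖y‖)
    (hw.contDiffOn.sub (hv.contDiffOn.mono hsub)) (hw.continuous.continuousOn.sub hcl)
    (fun x hx => by
      rw [hw.contDiffAt.laplacian_sub (hC x hx), laplacian_besselRadial hk, Pi.sub_apply]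
      linear_combination -hv.equation x (hsub hx))
    (fun x hx => by simp [hbd x hx]) 0 (Metric.mem_ball_self hr0)
  simp [besselRadial, besselProfile_zero] at h1 h2
  rw [hvr, le_antisymm h1 h2]

/-! ### The generalized principal eigenvalue -/

/-- A positive lower semicontinuous function on a compact set is touched from below by a positive
multiple of any nonnegative continuous function that is not identically zero. -/
theorem LowerSemicontinuousOn.exists_touching {E : Type*} [TopologicalSpace E] {K : Set E}
    (hK : IsCompact K) {φ w : E → ℝ} (hφ : LowerSemicontinuousOn φ K) (hφp : ∀ x ∈ K, 0 < φ x)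
    (hw : ContinuousOn w K) (hw0 : ∀ x ∈ K, 0 ≤ w x) (hwp : ∃ x ∈ K, 0 < w x) :
    ∃ t, 0 < t ∧ (∀ y ∈ K, t * w y ≤ φ y) ∧ ∃ x ∈ K, 0 < w x ∧ φ x = t * w x := by
  obtain ⟨z, hz, hzp⟩ := hwp
  set T : Set ℝ := {t | ∀ y ∈ K, t * w y ≤ φ y} with hT
  have hT0 : (0 : ℝ) ∈ T := fun y hy => by simpa using (hφp y hy).le
  have hTb : BddAbove T := ⟨φ z / w z, fun t ht => (le_div_iff₀ hzp).2 (ht z hz)⟩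
  set t := sSup T with ht
  have htT : ∀ y ∈ K, t * w y ≤ φ y := fun y hy => by
    rcases (hw0 y hy).eq_or_lt with h | h
    · simpa [← h] using (hφp y hy).le
    · exact (le_div_iff₀ h).1 (csSup_le ⟨0, hT0⟩ fun s hs => (le_div_iff₀ h).2 (hs y hy))
  have hlsc : LowerSemicontinuousOn (fun y => φ y + -(t * w y)) K :=
    hφ.add (ContinuousOn.lowerSemicontinuousOn (continuousOn_const.mul hw).neg)
  obtain ⟨x, hx, hmin⟩ := LowerSemicontinuousOn.exists_isMinOn ⟨z, hz⟩ hK hlsc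
  obtain ⟨y, hy, hmax⟩ := hK.exists_isMaxOn ⟨z, hz⟩ hw
  have hyp : 0 < w y := hzp.trans_le (hmax hz)
  have hxeq : φ x = t * w x := by
    refine le_antisymm ?_ (htT x hx)
    by_contra! hlt
    have hm : 0 < (φ x - t * w x) / w y := div_pos (by linarith) hyp
    -- A positive minimal gap `φ - t w` would allow to increase `t` by the gap divided by `max w`.
    have : t + (φ x - t * w x) / w y ∈ T := fun a ha => by
      have h1 : φ x + -(t * w x) ≤ φ a + -(t * w a) := hmin ha
      have h2 : w a ≤ w y := hmax ha
      have h3 : (φ x - t * w x) / w y * w a ≤ (φ x - t * w x) / w y * w y := by gcongr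
      rw [div_mul_cancel₀ _ hyp.ne'] at h3
      linarith
    linarith [le_csSup hTb this]
  have hxp := hφp x hx
  rw [hxeq] at hxp
  have htp : 0 < t := pos_of_mul_pos_left hxp (hw0 x hx)
  exact ⟨t, htp, htT, x, hx, pos_of_mul_pos_right hxp htp.le, hxeq⟩

theorem muPlus_ball_eq {N k : ℕ} (hk : 1 ≤ k) (hkN : k ≤ N) {Z : ℝ} (hZ : 0 < Z)
    (hZ0 : besselProfile k Z = 0) (hpos : ∀ s, 0 ≤ s → s < Z → 0 < besselProfile k s)
    {ρ : ℝ} (hρ : 0 < ρ) :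
    muPlus k (Metric.ball (0 : EuclideanSpace ℝ (Fin N)) ρ) = ((Z / ρ ^ 2 : ℝ) : EReal) := by
  have hpos4 : ∀ s, 0 ≤ s → s < Z → 0 < besselProfile (k + 4) s := fun s hs hsZ =>
    besselProfile_add_two_pos (by omega : 1 ≤ k + 2)
      (fun s hs hsZ => besselProfile_add_two_pos hk hpos hs hsZ) hs hsZ
  have hlt : ∀ {μ r : ℝ} (x : EuclideanSpace ℝ (Fin N)), 0 < μ → μ * r ^ 2 = Z → ‖x‖ < r →
      μ * ‖x‖ ^ 2 < Z := fun {μ r} x hμ h hx => by rw [← h]; gcongr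
  apply le_antisymm
  · refine sSup_le ?_
    rintro _ ⟨μ, ⟨φ, hφp, hlsc, hvisc⟩, rfl⟩
    refine EReal.coe_le_coe_iff.2 ?_
    by_contra! hμ
    -- For `Z / ρ² < μ' < μ`, a multiple of `g (μ' |x|²)` touches `φ` from below in the smaller
    -- ball of radius `√(Z / μ')`.
    obtain ⟨μ', h1, h2⟩ := exists_between hμ
    have hμ' : 0 < μ' := lt_trans (by positivity) h1
    set r := Real.sqrt (Z / μ') with hr
    have hr0 : 0 < r := Real.sqrt_pos.2 (by positivity)
    have hr2 : μ' * r ^ 2 = Z := by rw [hr, Real.sq_sqrt (by positivity)]; field_simp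
    have hrρ : r < ρ := by
      rw [hr, Real.sqrt_lt' hρ, div_lt_iff₀ hμ']
      rw [div_lt_iff₀ (by positivity)] at h1
      linarith
    have hw := contDiff_besselRadial hk N 1 μ'
    have hsub : Metric.closedBall (0 : EuclideanSpace ℝ (Fin N)) r ⊆ Metric.ball 0 ρ :=
      Metric.closedBall_subset_ball hrρ
    have hws : ∀ x ∈ Metric.sphere (0 : EuclideanSpace ℝ (Fin N)) r,
        besselRadial k N 1 μ' x = 0 := fun x hx => by
      rw [mem_sphere_zero_iff_norm] at hx
      rw [besselRadial, hx, hr2, hZ0, mul_zero]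
    obtain ⟨t, ht, hle, x, hx, hwx, hxeq⟩ := LowerSemicontinuousOn.exists_touching
      (isCompact_closedBall 0 r) (hlsc.mono hsub) (fun x hx => hφp x (hsub hx))
      hw.continuous.continuousOn
      (fun x hx => by
        rcases (mem_closedBall_zero_iff.1 hx).eq_or_lt with h | h
        · exact (hws x (mem_sphere_zero_iff_norm.2 h)).ge
        · rw [besselRadial, one_mul]
          exact (hpos _ (by positivity) (hlt x hμ' hr2 h)).le)
      ⟨0, Metric.mem_closedBall_self hr0.le, by simp [besselRadial, besselProfile_zero]⟩
    have hxr : ‖x‖ < r := lt_of_le_of_ne (mem_closedBall_zero_iff.1 hx) fun h =>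
      hwx.ne' (hws x (mem_sphere_zero_iff_norm.2 h))
    have hmul : ∀ y, besselRadial k N t μ' y = t * besselRadial k N 1 μ' y := fun y => by
      simp [besselRadial]
    have hmin : IsLocalMin (fun y => φ y - besselRadial k N t μ' y) x := by
      filter_upwards [Metric.isOpen_ball.mem_nhds (mem_ball_zero_iff.2 hxr)] with y hy
      have := hle y (Metric.ball_subset_closedBall hy)
      rw [hmul, hmul, hxeq]
      linarith
    have hv := hvisc x (hsub hx) _ (contDiff_besselRadial hk N t μ').contDiffAt hmin
    rw [truncatedPlus_besselRadial hk hkN ht.le x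
      (hpos4 _ (by positivity) (hlt x hμ' hr2 hxr)).le, hmul, ← hxeq] at hv
    have := hφp x (hsub hx)
    nlinarith
  · have hμ : 0 < Z / ρ ^ 2 := by positivity
    have hμρ : Z / ρ ^ 2 * ρ ^ 2 = Z := by field_simp
    refine le_sSup ⟨Z / ρ ^ 2, ⟨besselRadial k N 1 (Z / ρ ^ 2), fun x hx => ?_, ?_, ?_⟩, rfl⟩
    · rw [besselRadial, one_mul]
      exact hpos _ (by positivity) (hlt x hμ hμρ (mem_ball_zero_iff.1 hx))
    · exact (contDiff_besselRadial hk N 1 _).continuous.continuousOn.lowerSemicontinuousOn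
    · intro x hx ψ hψ hmin
      have := truncatedPlus_le_besselRadial hk hkN zero_le_one
        (hpos4 _ (by positivity) (hlt x hμ hμρ (mem_ball_zero_iff.1 hx))).le hψ hmin
      linarith

/-! ### The eigenvalue and the eigenfunction of the truncated Laplacian -/

theorem mainTheorem8 (N k : ℕ) (hk : 1 ≤ k) (hkN : k ≤ N) (ρ : ℝ) (hρ : 0 < ρ) :
    IsLeast {μ : ℝ | ∃ φ : EuclideanSpace ℝ (Fin k) → ℝ,
        IsDirichletEigenfunction (Metric.ball 0 ρ) μ φ} (muLaplacianBall k ρ) ∧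
    (∃ v : ℝ → ℝ, IsRadialFirstEigenfunction k ρ v) ∧
    (∀ v : ℝ → ℝ, IsRadialFirstEigenfunction k ρ v →
      ∀ u : EuclideanSpace ℝ (Fin N) → ℝ, (∀ x, u x = v ‖x‖) →
        ContDiffOn ℝ 2 u (Metric.ball 0 ρ) ∧
        ContinuousOn u (Metric.closedBall 0 ρ) ∧
        (∀ x ∈ Metric.ball 0 ρ, 0 < u x) ∧
        (∀ x ∈ Metric.sphere 0 ρ, u x = 0) ∧
        (∀ x ∈ Metric.ball 0 ρ,
          truncatedPlus k (hessianMatrix u x) + muLaplacianBall k ρ * u x = 0)) ∧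
    muPlus k (Metric.ball (0 : EuclideanSpace ℝ (Fin N)) ρ) =
      ((muLaplacianBall k ρ : ℝ) : EReal) := by
  obtain ⟨Z, hZ, hZ0, hpos⟩ := exists_besselProfile_first_zero hk
  have hleast := isLeast_dirichlet_eigenvalues hk hZ hZ0 hpos hρ
  have hmu : muLaplacianBall k ρ = Z / ρ ^ 2 := hleast.csInf_eq
  have hZρ : Z / ρ ^ 2 * ρ ^ 2 = Z := by field_simp
  have hin : ∀ {r : ℝ}, 0 ≤ r → r < ρ → 0 ≤ Z / ρ ^ 2 * r ^ 2 ∧ Z / ρ ^ 2 * r ^ 2 < Z :=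
    fun {r} h0 h => by
      refine ⟨by positivity, ?_⟩
      conv_rhs => rw [← hZρ]
      gcongr
  have hpos4 : ∀ s, 0 ≤ s → s < Z → 0 < besselProfile (k + 4) s := fun s hs hsZ =>
    besselProfile_add_two_pos (by omega : 1 ≤ k + 2)
      (fun s hs hsZ => besselProfile_add_two_pos hk hpos hs hsZ) hs hsZ
  unfold IsRadialFirstEigenfunction
  rw [hmu]
  refine ⟨hleast, ⟨fun r => besselProfile k (Z / ρ ^ 2 * r ^ 2), ?_, fun y hy => ?_⟩, ?_,
    muPlus_ball_eq hk hkN hZ hZ0 hpos hρ⟩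
  · have := isDirichletEigenfunction_besselRadial hk hZ0 hρ
    have e : besselRadial k k 1 (Z / ρ ^ 2) = fun y => besselProfile k (Z / ρ ^ 2 * ‖y‖ ^ 2) :=
      funext fun y => one_mul _
    rwa [e] at this
  · obtain ⟨h1, h2⟩ := hin (norm_nonneg y) (mem_ball_zero_iff.1 hy)
    exact hpos _ h1 h2
  rintro v ⟨hv, hvp⟩ u hu
  have hv0 : 0 < v 0 := by simpa using hvp 0 (Metric.mem_ball_self hρ)
  have hueq : Set.EqOn u (besselRadial k N (v 0) (Z / ρ ^ 2)) (Metric.closedBall 0 ρ) :=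
    fun x hx => (hu x).trans
      (radial_eigenfunction_eq hk hZ hZ0 hpos hρ hv (norm_nonneg x) (mem_closedBall_zero_iff.1 hx))
  have hw := contDiff_besselRadial hk N (v 0) (Z / ρ ^ 2)
  refine ⟨hw.contDiffOn.congr fun x hx => hueq (Metric.ball_subset_closedBall hx),
    hw.continuous.continuousOn.congr hueq, fun x hx => ?_, fun x hx => ?_, fun x hx => ?_⟩
  · obtain ⟨h1, h2⟩ := hin (norm_nonneg x) (mem_ball_zero_iff.1 hx)
    rw [hueq (Metric.ball_subset_closedBall hx)]
    exact mul_pos hv0 (hpos _ h1 h2)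
  · rw [hueq (Metric.sphere_subset_closedBall hx), besselRadial, mem_sphere_zero_iff_norm.1 hx,
      hZρ, hZ0, mul_zero]
  · obtain ⟨h1, h2⟩ := hin (norm_nonneg x) (mem_ball_zero_iff.1 hx)
    have hev : u =ᶠ[nhds x] besselRadial k N (v 0) (Z / ρ ^ 2) := by
      filter_upwards [Metric.isOpen_ball.mem_nhds hx] with y hy
      exact hueq (Metric.ball_subset_closedBall hy)
    rw [hessianMatrix_congr hev, truncatedPlus_besselRadial hk hkN hv0.le x (hpos4 _ h1 h2).le,
      hueq (Metric.ball_subset_closedBall hx)]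
    ring
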